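/- Let $d\ge 1$ and let $\Omega\subset\mathbb{R}^d$ be a bounded connected open set with boundary of class $C^2$. Let $L:\mathbb{R}^d\times\mathbb{R}^d\to\mathbb{R}$ be a Tonelli Lagrangian: $L$ is of class $C^2$; $D^2_{vv}L(x,v)$ is positive definite for all $(x,v)$; for every $K\ge 0$ there is $C(K)\in\mathbb{R}$ with $L(x,v)\ge K|v|-C(K)$ for all $(x,v)$; and $\sup\{L(x,v): x\in\mathbb{R}^d,\ |v|\le R\}<+\infty$ for every $R\ge 0$. Let $H(x,p)=\sup_{v\in\mathbb{R}^d}\{\langle p,v\rangle-L(x,v)\}$ be the associated Hamiltonian, and assume that it is reversible, i.e. $H(x,-p)=H(x,p)$ for all $(x,p)$. Assume (A1) $\ \operatorname{argmin}_{x\in\mathbb{R}^d}L(x,0)\cap\overline\Omega\neq\emptyset$. A function $u\in C(\overline\Omega)$ is a constrained viscosity solution of $H(x,Du)=c$ on $\overline\Omega$ if, for every $\varphi\in C^1(\mathbb{R}^d)$, $H(x_0,D\varphi(x_0))\le c$ at every local maximum point $x_0\in\Omega$ of $u-\varphi$ on $\Omega$, and $H(x_0,D\varphi(x_0))\ge c$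 at every local minimum point $x_0\in\overline\Omega$ of $u-\varphi$ relative to $\overline\Omega$. Then there is exactly one constant $c_H\in\mathbb{R}$ such that $H(x,Du)=c_H$ has a constrained viscosity solution on $\overline\Omega$; Mañé's critical value $$c_L:=\sup\Big\{k\in\mathbb{R}:\ \int_a^b\big(L(\gamma(s),\dot\gamma(s))+k\big)\,ds<0\ \text{ for some } a<b \text{ and some absolutely continuous } \gamma:[a,b]\to\mathbb{R}^d \text{ with } \gamma(a)=\gamma(b)\Big\}$$ is a finite supremum; and $$c_H=c_L=-\min_{x\in\mathbb{R}^d}L(x,0).$$ -/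

import Mathlib

open Set Topology

noncomputable section

/-- `ℝ^d` with its Euclidean structure. -/
abbrev Eucl (d : ℕ) : Type := EuclideanSpace ℝ (Fin d)

/-- Tonelli Lagrangians on `ℝ^d × ℝ^d`: of class `C²`, with positive definite second derivative in
the velocity, uniformly superlinear in the velocity, and bounded above on `ℝ^d × {|v| ≤ R}` for
every `R`. -/
structure IsTonelli {d : ℕ} (L : Eucl d → Eucl d → ℝ) : Prop where
  contDiff : ContDiff ℝ 2 (fun z : Eucl d × Eucl d => L z.1 z.2)
  posDef : ∀ x v w : Eucl d, w ≠ 0 → 0 < fderiv ℝ (fderiv ℝ (L x)) v w w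
  superlinear : ∀ K : ℝ, ∃ C : ℝ, ∀ x v : Eucl d, K * ‖v‖ - C ≤ L x v
  bounded : ∀ R : ℝ, ∃ A : ℝ, ∀ x v : Eucl d, ‖v‖ ≤ R → L x v ≤ A

/-- The Hamiltonian associated with `L`: `H(x,p) = sup_v (⟨p,v⟩ - L(x,v))`. -/
def hamiltonian {d : ℕ} (L : Eucl d → Eucl d → ℝ) (x p : Eucl d) : ℝ :=
  ⨆ v : Eucl d, (inner ℝ p v - L x v)

/-- The Hamiltonian is even in the momentum. -/
def IsReversible {d : ℕ} (H : Eucl d → Eucl d → ℝ) : Prop :=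
  ∀ x p : Eucl d, H x (-p) = H x p

/-- The boundary of `Ω` is of class `C²`: near each of its points, `Ω` is the set where a `C²`
function with non-vanishing differential at that point is negative. -/
def HasC2Boundary {d : ℕ} (Ω : Set (Eucl d)) : Prop :=
  ∀ x ∈ frontier Ω, ∃ (U : Set (Eucl d)) (b : Eucl d → ℝ),
    IsOpen U ∧ x ∈ U ∧ ContDiffOn ℝ 2 b U ∧ fderiv ℝ b x ≠ 0 ∧ Ω ∩ U = {y ∈ U | b y < 0}

/-- The set of all real `k` such that `A_{L+k}(γ) < 0` for some closed absolutely continuous curve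
`γ : [a,b] → ℝ^d`, `a < b`. For a Lagrangian that is bounded below, the action of a curve along
which it is not integrable is `+∞`, so such curves do not count. -/
def negativeActionLevels {d : ℕ} (L : Eucl d → Eucl d → ℝ) : Set ℝ :=
  {k | ∃ (a b : ℝ) (γ : ℝ → Eucl d), a < b ∧ AbsolutelyContinuousOnInterval γ a b ∧ γ a = γ b ∧
    IntervalIntegrable (fun s => L (γ s) (deriv γ s)) MeasureTheory.volume a b ∧
    ∫ s in a..b, (L (γ s) (deriv γ s) + k) < 0}

/-- Mañé's critical value `c_L`. -/
def maneCriticalValue {d : ℕ} (L : Eucl d → Eucl d → ℝ) : ℝ :=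
  sSup (negativeActionLevels L)

/-- `u` is a viscosity subsolution of `H(x,Du) = c` on `S`; maxima are relative to `S`. -/
def IsViscositySubsolutionOn {d : ℕ} (S : Set (Eucl d)) (H : Eucl d → Eucl d → ℝ) (c : ℝ)
    (u : Eucl d → ℝ) : Prop :=
  ∀ φ : Eucl d → ℝ, ContDiff ℝ 1 φ → ∀ x₀ ∈ S,
    IsLocalMaxOn (fun x => u x - φ x) S x₀ → H x₀ (gradient φ x₀) ≤ c

/-- `u` is a viscosity supersolution of `H(x,Du) = c` on `S`; minima are relative to `S`. -/
def IsViscositySupersolutionOn {d : ℕ} (S : Set (Eucl d)) (H : Eucl d → Eucl d → ℝ) (c : ℝ)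
    (u : Eucl d → ℝ) : Prop :=
  ∀ φ : Eucl d → ℝ, ContDiff ℝ 1 φ → ∀ x₀ ∈ S,
    IsLocalMinOn (fun x => u x - φ x) S x₀ → c ≤ H x₀ (gradient φ x₀)

/-- `u` is a constrained viscosity solution of `H(x,Du) = c` on the closure of `Ω`. Only the values
of `u` on that closure matter. -/
def IsConstrainedViscositySolution {d : ℕ} (Ω : Set (Eucl d)) (H : Eucl d → Eucl d → ℝ) (c : ℝ)
    (u : Eucl d → ℝ) : Prop :=
  ContinuousOn u (closure Ω) ∧ IsViscositySubsolutionOn Ω H c u ∧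
    IsViscositySupersolutionOn (closure Ω) H c u

/-- The state constraint problem `H(x,Du) ≤ c` in `Ω`, `H(x,Du) ≥ c` on the closure of `Ω`, has a
solution. -/
def StateConstraintSolvable {d : ℕ} (Ω : Set (Eucl d)) (H : Eucl d → Eucl d → ℝ) (c : ℝ) : Prop :=
  ∃ u : Eucl d → ℝ, IsConstrainedViscositySolution Ω H c u

/-- The state-constrained critical value `c_H`: the constant for which the state constraint problem
has a solution (meaningful when there is exactly one such constant). -/
def constrainedCriticalValue {d : ℕ} (Ω : Set (Eucl d)) (H : Eucl d → Eucl d → ℝ) : ℝ :=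
  Classical.epsilon (StateConstraintSolvable Ω H)

end

/-! Reversibility and convexity make `L x` minimal at zero velocity, so `-L x 0` is both the value
of `H` at zero momentum and its minimum over all momenta. By (A1) some `z` in the closure of `Ω`
then minimises `L` over the whole phase space, and resting at `z` is optimal among closed curves;
this gives Mañé's value (`negativeActionLevels_eq_Iio`).

Uniqueness of the constant (`eq_neg`) needs no comparison principle. A subsolution can be tested on
a dense set, where `H ≥ -L x 0` forces `c ≥ -L z 0`. A supersolution can be tested with a constant
at its minimum, which gives `c ≤ -L z 0`.

Existence is Perron's method at the level `c = -L z 0`, applied to functions dominated by the action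
of segments and vanishing at `z`. They are equi-Lipschitz near each point of the closure, so their
envelope is finite and dominated, hence a subsolution. Away from `z`, failure of the supersolution
test would allow the envelope to be raised (`exists_dominated_gt`); at `z` the test holds for every
momentum. -/

/-- The derivative of a function along a line. -/
theorem hasDerivAt_comp_line {d : ℕ} {φ : Eucl d → ℝ} (hφ : Differentiable ℝ φ) (x q : Eucl d)
    (s : ℝ) : HasDerivAt (fun t : ℝ => φ (x + t • q)) (inner ℝ (gradient φ (x + s • q)) q) s := by
  have hd : HasDerivAt (fun t : ℝ => x + t • q) q s := by
    simpa using ((hasDerivAt_id s).smul_const q).const_add x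
  have h := (hφ (x + s • q)).hasFDerivAt.comp_hasDerivAt s hd
  have he : inner ℝ (gradient φ (x + s • q)) q = fderiv ℝ φ (x + s • q) q := by simp [gradient]
  rw [he]
  exact h

/-! ### Convexity, duality and reversibility -/

namespace IsTonelli

variable {d : ℕ} {L : Eucl d → Eucl d → ℝ}

theorem continuous (hL : IsTonelli L) : Continuous fun z : Eucl d × Eucl d => L z.1 z.2 :=
  hL.contDiff.continuous

theorem contDiff_velocity (hL : IsTonelli L) (x : Eucl d) : ContDiff ℝ 2 (L x) :=
  hL.contDiff.comp (contDiff_const.prodMk contDiff_id : ContDiff ℝ 2 fun v : Eucl d => (x, v))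

theorem bddAbove (hL : IsTonelli L) (x p : Eucl d) :
    BddAbove (range fun v : Eucl d => inner ℝ p v - L x v) := by
  obtain ⟨C, hC⟩ := hL.superlinear ‖p‖
  refine ⟨C, ?_⟩
  rintro _ ⟨v, rfl⟩
  have h₁ := hC x v
  have h₂ := real_inner_le_norm p v
  simp only
  linarith

theorem inner_sub_le_hamiltonian (hL : IsTonelli L) (x p v : Eucl d) :
    inner ℝ p v - L x v ≤ hamiltonian L x p :=
  le_ciSup (hL.bddAbove x p) v

theorem neg_le_hamiltonian (hL : IsTonelli L) (x p : Eucl d) : -L x 0 ≤ hamiltonian L x p := by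
  simpa using hL.inner_sub_le_hamiltonian x p 0

theorem hamiltonian_le {x p : Eucl d} {c : ℝ} (h : ∀ v, inner ℝ p v ≤ L x v + c) :
    hamiltonian L x p ≤ c :=
  ciSup_le fun v => by linarith [h v]

/-- The graph of `L x` lies above its tangent plane at the zero velocity. -/
theorem tangent_le (hL : IsTonelli L) (x v : Eucl d) :
    L x 0 + fderiv ℝ (L x) 0 v ≤ L x v := by
  rcases eq_or_ne v 0 with rfl | hv
  · simp
  have hC := hL.contDiff_velocity x
  have hline : ∀ t : ℝ, HasDerivAt (fun t : ℝ => t • v) v t := fun t => by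
    simpa using (hasDerivAt_id t).smul_const v
  have h₁ : ∀ t : ℝ, HasDerivAt (fun t : ℝ => L x (t • v)) (fderiv ℝ (L x) (t • v) v) t :=
    fun t => ((hC.differentiable (by norm_num)) (t • v)).hasFDerivAt.comp_hasDerivAt t (hline t)
  have hC' : Differentiable ℝ (fderiv ℝ (L x)) :=
    (hC.fderiv_right (m := 1) (by norm_num)).differentiable (by norm_num)
  have h₂ : ∀ t : ℝ, HasDerivAt (fun t : ℝ => fderiv ℝ (L x) (t • v) v)
      (fderiv ℝ (fderiv ℝ (L x)) (t • v) v v) t := fun t => by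
    exact ((ContinuousLinearMap.apply ℝ ℝ v).hasFDerivAt
      (x := fderiv ℝ (L x) (t • v))).comp_hasDerivAt t
      ((hC' (t • v)).hasFDerivAt.comp_hasDerivAt t (hline t))
  have hmono : Monotone fun t : ℝ => fderiv ℝ (L x) (t • v) v :=
    monotone_of_hasDerivAt_nonneg h₂ fun t => (hL.posDef x (t • v) v hv).le
  obtain ⟨ξ, hξ, hξ'⟩ := exists_hasDerivAt_eq_slope (fun t : ℝ => L x (t • v)) _ zero_lt_one
    (fun t _ => (h₁ t).continuousAt.continuousWithinAt) (fun t _ => h₁ t)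
  have := hmono hξ.1.le
  simp only [zero_smul, one_smul] at this hξ'
  norm_num at hξ'
  linarith

/-- For a reversible Hamiltonian, the Lagrangian is minimal at the zero velocity. -/
theorem le_of_reversible (hL : IsTonelli L) (hrev : IsReversible (hamiltonian L))
    (x v : Eucl d) : L x 0 ≤ L x v := by
  -- Convexity gives `H(x,p) ≤ -L x 0`, and evenness carries this to `-p`. So `L x v` lies above
  -- both `L x 0 + ⟨p,v⟩` and `L x 0 - ⟨p,v⟩`, hence above their mean.
  set p : Eucl d := gradient (L x) 0 with hp
  have hpv : ∀ w, inner ℝ p w = fderiv ℝ (L x) 0 w := fun w => by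
    simp [hp, gradient]
  have h₁ := hL.tangent_le x v
  have h₂ : hamiltonian L x p ≤ -L x 0 :=
    hamiltonian_le fun w => by rw [hpv]; linarith [hL.tangent_le x w]
  have h₃ := hL.inner_sub_le_hamiltonian x (-p) v
  rw [hrev, inner_neg_left, hpv] at h₃
  linarith

theorem hamiltonian_zero_le (hL : IsTonelli L) (hrev : IsReversible (hamiltonian L))
    (x : Eucl d) : hamiltonian L x 0 ≤ -L x 0 :=
  hamiltonian_le fun v => by simpa using hL.le_of_reversible hrev x v

/-- The strict inequality `H(x, P(x)) < c` is an open condition, uniformly in the velocity. -/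
theorem eventually_inner_le (hL : IsTonelli L) {P : Eucl d → Eucl d} (hP : Continuous P)
    {x₀ : Eucl d} {c : ℝ} (h : hamiltonian L x₀ (P x₀) < c) :
    ∀ᶠ x in 𝓝 x₀, ∀ v, inner ℝ (P x) v ≤ L x v + c := by
  -- Near `x₀` this slope exceeds `‖P x‖` by at least 1, which settles `‖v‖ > |C - c|`; compactness
  -- handles the other velocities.
  obtain ⟨C, hC⟩ := hL.superlinear (‖P x₀‖ + 2)
  have hlarge : ∀ᶠ x in 𝓝 x₀, ‖P x‖ < ‖P x₀‖ + 1 :=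
    hP.norm.continuousAt.eventually_lt continuousAt_const (by linarith)
  have hcont : Continuous fun z : Eucl d × Eucl d => L z.1 z.2 + c - inner ℝ (P z.1) z.2 :=
    (hL.continuous.add continuous_const).sub ((hP.comp continuous_fst).inner continuous_snd)
  have hsmall : ∀ᶠ x in 𝓝 x₀, ∀ v ∈ Metric.closedBall (0 : Eucl d) |C - c|,
      0 < L x v + c - inner ℝ (P x) v := by
    refine (isCompact_closedBall _ _).eventually_forall_of_forall_eventually fun v _ => ?_
    refine hcont.continuousAt.eventually (lt_mem_nhds ?_)
    have := hL.inner_sub_le_hamiltonian x₀ (P x₀) v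
    simp only
    linarith
  filter_upwards [hlarge, hsmall] with x hx₁ hx₂ v
  by_cases hv : ‖v‖ ≤ |C - c|
  · linarith [hx₂ v (by simpa using hv)]
  · have h₁ := hC x v
    have h₂ := real_inner_le_norm (P x) v
    have h₃ := mul_le_mul_of_nonneg_right hx₁.le (norm_nonneg v)
    have h₄ := le_abs_self (C - c)
    push Not at hv
    nlinarith

end IsTonelli

/-! ### Mañé's critical value -/

section Mane

variable {d : ℕ} {L : Eucl d → Eucl d → ℝ}

/-- If `L` attains its minimum over the whole phase space at the rest point `(x, 0)`, then closed
curves have negative action exactly at the levels below `-L x 0`. -/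
theorem negativeActionLevels_eq_Iio {x : Eucl d} (hx : ∀ y v, L x 0 ≤ L y v) :
    negativeActionLevels L = Iio (-L x 0) := by
  ext k
  constructor
  · rintro ⟨a, b, γ, hab, -, -, -, hneg⟩
    by_contra hk
    rw [mem_Iio, not_lt] at hk
    refine absurd hneg (not_lt.2 (intervalIntegral.integral_nonneg hab.le fun s _ => ?_))
    linarith [hx (γ s) (deriv γ s)]
  · intro hk
    refine ⟨0, 1, fun _ => x, zero_lt_one, ?_, rfl, ?_, ?_⟩
    · exact ((LipschitzWith.const x).lipschitzOnWith (K := 0)).absolutelyContinuousOnInterval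
    · simp
    · rw [mem_Iio] at hk
      simp
      linarith

end Mane

/-! ### Domination along segments -/

section Domination

variable {d : ℕ} {Ω : Set (Eucl d)} {L : Eucl d → Eucl d → ℝ} {c : ℝ}

/-- `v` is dominated by `L + c` along the segments contained in `Ω` and travelled at constant
velocity. The action of a segment is replaced by its upper bounds `h * K`. -/
def IsDominated (Ω : Set (Eucl d)) (L : Eucl d → Eucl d → ℝ) (c : ℝ) (v : Eucl d → ℝ) : Prop :=
  ∀ (x q : Eucl d) (h K : ℝ), 0 ≤ h →
    (∀ s ∈ Icc 0 h, x + s • q ∈ Ω ∧ L (x + s • q) q + c ≤ K) → v (x + h • q) - v x ≤ K * h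

/-- Travelling the segment at unit speed makes its duration equal to its length. The resulting
Lipschitz constant does not depend on `v`. -/
theorem IsDominated.sub_le_of_segment {v : Eucl d → ℝ} (hv : IsDominated Ω L c v) {K : ℝ}
    (hK : ∀ x q, ‖q‖ ≤ 1 → L x q + c ≤ K) {x y : Eucl d} (hxy : segment ℝ x y ⊆ Ω) :
    v y - v x ≤ K * ‖y - x‖ := by
  rcases eq_or_ne x y with rfl | hne
  · simp
  have hpos : 0 < ‖y - x‖ := norm_pos_iff.2 (sub_ne_zero.2 hne.symm)
  have := hv x (‖y - x‖⁻¹ • (y - x)) ‖y - x‖ K hpos.le fun s hs => ⟨hxy ?_, hK _ _ ?_⟩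
  · rwa [smul_inv_smul₀ hpos.ne', add_sub_cancel] at this
  · rw [segment_eq_image']
    refine ⟨s * ‖y - x‖⁻¹, ⟨mul_nonneg hs.1 (inv_nonneg.2 hpos.le), ?_⟩, by simp [smul_smul]⟩
    rw [← div_eq_mul_inv, div_le_one hpos]
    exact hs.2
  · rw [norm_smul, norm_inv, norm_norm, inv_mul_cancel₀ hpos.ne']

/-- A dominated function is a viscosity subsolution. -/
theorem IsDominated.isViscositySubsolutionOn {u : Eucl d → ℝ} (hu : IsDominated Ω L c u)
    (hL : IsTonelli L) (hΩ : IsOpen Ω) : IsViscositySubsolutionOn Ω (hamiltonian L) c u := by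
  intro φ hφ x₀ hx₀ hmax
  refine IsTonelli.hamiltonian_le fun q => le_of_forall_pos_le_add fun ε hε => ?_
  set K := L x₀ q + c + ε with hK
  have hline : Continuous fun s : ℝ => x₀ + s • q := by fun_prop
  have hx0 : x₀ + (0 : ℝ) • q = x₀ := by simp
  -- near `x₀`, the segment stays in `Ω`, the Lagrangian is below `K` and `u - φ` is maximal
  have hev : ∀ᶠ s : ℝ in 𝓝 0, (x₀ + s • q ∈ Ω ∧ L (x₀ + s • q) q + c ≤ K) ∧
      u (x₀ + s • q) - φ (x₀ + s • q) ≤ u x₀ - φ x₀ := by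
    have h₁ : ∀ᶠ s : ℝ in 𝓝 0, x₀ + s • q ∈ Ω :=
      hline.continuousAt.eventually (by beta_reduce; rw [hx0]; exact hΩ.mem_nhds hx₀)
    have h₂ : ∀ᶠ s : ℝ in 𝓝 0, L (x₀ + s • q) q + c < K := by
      have : Continuous fun s : ℝ => L (x₀ + s • q) q + c :=
        (hL.continuous.comp (hline.prodMk continuous_const)).add continuous_const
      refine this.continuousAt.eventually (gt_mem_nhds ?_)
      beta_reduce
      rw [hx0]
      linarith
    have h₃ : ∀ᶠ s : ℝ in 𝓝 0, u (x₀ + s • q) - φ (x₀ + s • q) ≤ u x₀ - φ x₀ := by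
      have : ∀ᶠ x in 𝓝 x₀, u x - φ x ≤ u x₀ - φ x₀ := by
        have h := hmax
        rw [IsLocalMaxOn, IsMaxFilter, hΩ.nhdsWithin_eq hx₀] at h
        exact h
      rw [← hx0] at this
      simpa only [hx0] using hline.continuousAt.eventually this
    filter_upwards [h₁, h₂, h₃] with s a b e using ⟨⟨a, b.le⟩, e⟩
  have hder : HasDerivAt (fun s : ℝ => φ (x₀ + s • q)) (inner ℝ (gradient φ x₀) q) 0 := by
    simpa only [hx0] using hasDerivAt_comp_line (hφ.differentiable (by norm_num)) x₀ q 0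
  -- Left slopes are used: domination along segments arriving at `x₀` bounds the increase of `u`,
  -- and maximality transfers the bound to `φ`.
  have hlim := (hasDerivAt_iff_tendsto_slope.1 hder).mono_left
    (nhdsWithin_mono 0 fun s (hs : s ∈ Iio 0) => ne_of_lt hs)
  refine le_of_tendsto hlim ?_
  obtain ⟨r, hr, hball⟩ := Metric.eventually_nhds_iff.1 hev
  have hIoo : Ioo (-r) 0 ∈ 𝓝[<] (0 : ℝ) := Ioo_mem_nhdsLT (by linarith)
  filter_upwards [hIoo] with s hs
  have hdom := hu (x₀ + s • q) q (-s) K (by linarith [hs.2]) fun t ht => by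
    have := (hball (y := s + t) (by
      rw [Real.dist_eq, sub_zero, abs_lt]; constructor <;> linarith [hs.1, hs.2, ht.1, ht.2])).1
    rwa [add_assoc, ← add_smul]
  have hmx := (hball (y := s) (by
    rw [Real.dist_eq, sub_zero, abs_lt]; constructor <;> linarith [hs.1, hs.2])).2
  rw [add_assoc, ← add_smul, add_neg_cancel, hx0] at hdom
  rw [slope_def_field, hx0, sub_zero, div_le_iff_of_neg hs.2]
  linarith

end Domination

/-! ### Lipschitz estimates up to the boundary -/

section Boundary

variable {d : ℕ} {Ω : Set (Eucl d)}

/-- Near each point of the closure of an open set with `C²` boundary, functions which are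
`K`-Lipschitz along the segments in the set are Lipschitz with a common constant. -/
theorem HasC2Boundary.exists_lipschitzOnWith (hΩ2 : HasC2Boundary Ω) (hΩ : IsOpen Ω) {K : ℝ}
    (hK : 0 ≤ K) {z : Eucl d} (hz : z ∈ closure Ω) :
    ∃ r > 0, ∃ C : NNReal, ∀ v : Eucl d → ℝ,
      (∀ x y, segment ℝ x y ⊆ Ω → v y - v x ≤ K * ‖y - x‖) →
      LipschitzOnWith C v (Ω ∩ Metric.ball z r) := by
  by_cases hzΩ : z ∈ Ω
  · obtain ⟨r, hr, hball⟩ := Metric.isOpen_iff.1 hΩ z hzΩ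
    refine ⟨r, hr, K.toNNReal, fun v hv => LipschitzOnWith.of_le_add_mul _ fun x hx y hy => ?_⟩
    have := hv y x (((convex_ball z r).segment_subset hy.2 hx.2).trans hball)
    rw [dist_eq_norm, Real.coe_toNNReal K hK]
    linarith
  obtain ⟨U, b, hU, hzU, hb, hb', hΩU⟩ := hΩ2 z (by rw [hΩ.frontier_eq]; exact ⟨hz, hzΩ⟩)
  set B := fderiv ℝ b z with hB
  -- `n` points into `Ω`
  obtain ⟨n, hn⟩ : ∃ n, B n = -1 := by
    obtain ⟨w, hw⟩ : ∃ w, B w ≠ 0 := by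
      by_contra! h
      exact hb' (ContinuousLinearMap.ext h)
    exact ⟨(-(B w)⁻¹) • w, by simp [hw]⟩
  set N := ‖n‖ with hN
  have hNpos : 0 < N := norm_pos_iff.2 fun h => by simp [h] at hn
  -- With this `ε` the linearisation error along `n` costs at most half of the decrease of `b`.
  set ε : ℝ := 1 / (2 * N) with hε
  have hεpos : 0 < ε := by positivity
  have hεN : ε * N = 1 / 2 := by rw [hε]; field_simp
  have hstrict : HasStrictFDerivAt b B z :=
    (hb.contDiffAt (hU.mem_nhds hzU)).hasStrictFDerivAt (by norm_num)
  obtain ⟨ρ, hρ, hball⟩ : ∃ ρ > 0, ∀ x ∈ Metric.ball z ρ, x ∈ U ∧ ∀ y ∈ Metric.ball z ρ,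
      b y ≤ b x + B (y - x) + ε * ‖y - x‖ := by
    have h₁ := hstrict.isLittleO.def hεpos
    obtain ⟨ρ, hρ, hsub⟩ := Metric.eventually_nhds_iff_ball.1 h₁
    obtain ⟨ρ', hρ', hsub'⟩ := Metric.isOpen_iff.1 hU z hzU
    refine ⟨min ρ ρ', lt_min hρ hρ', fun x hx => ⟨hsub'
      (Metric.ball_subset_ball (min_le_right _ _) hx), fun y hy => ?_⟩⟩
    have := hsub (y, x) (by
      rw [← ball_prod_same]
      exact ⟨Metric.ball_subset_ball (min_le_left _ _) hy,
        Metric.ball_subset_ball (min_le_left _ _) hx⟩)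
    simp only [Real.norm_eq_abs] at this
    linarith [(abs_le.1 this).2]
  -- The remaining decrease `s / 2` absorbs the effect `(‖B‖ + ε) * ‖e‖` of a displacement `e` as
  -- soon as `M * ‖e‖ ≤ s`.
  set M : ℝ := 2 * (‖B‖ + ε) with hM
  have hMpos : 0 < M := by positivity
  set r : ℝ := ρ / (3 + 2 * M * N) with hr
  have hrpos : 0 < r := by positivity
  have hrρ : r * (3 + 2 * M * N) = ρ := by rw [hr]; field_simp
  -- moving by `s • n + e` with `e` small with respect to `s` keeps a point in `Ω`
  have hstay : ∀ x ∈ Ω ∩ Metric.ball z r, ∀ (s : ℝ) (e : Eucl d), 0 ≤ s → s ≤ M * (2 * r) →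
      ‖e‖ ≤ 2 * r → M * ‖e‖ ≤ s → x + s • n + e ∈ Ω := by
    intro x hx s e hs hs' he hes
    have hxz := mem_ball_iff_norm.1 hx.2
    have hsN : ‖s • n‖ = s * N := by rw [norm_smul, Real.norm_of_nonneg hs]
    have hsN' : s * N ≤ M * (2 * r) * N := mul_le_mul_of_nonneg_right hs' hNpos.le
    have hxρ : x ∈ Metric.ball z ρ :=
      Metric.ball_subset_ball (by nlinarith [mul_pos hMpos hNpos]) hx.2
    have hyρ : x + s • n + e ∈ Metric.ball z ρ := by
      rw [mem_ball_iff_norm]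
      calc ‖x + s • n + e - z‖ = ‖(x - z) + s • n + e‖ := by congr 1; abel
        _ ≤ ‖x - z‖ + ‖s • n‖ + ‖e‖ := norm_add₃_le
        _ < r + M * (2 * r) * N + 2 * r := by rw [hsN]; linarith
        _ = ρ := by rw [← hrρ]; ring
    have hbx : b x < 0 := by
      have : x ∈ Ω ∩ U := ⟨hx.1, (hball x hxρ).1⟩
      rw [hΩU] at this
      exact this.2
    have hmain := (hball x hxρ).2 _ hyρ
    have hsub : x + s • n + e - x = s • n + e := by abel
    have hBe : B e ≤ ‖B‖ * ‖e‖ := (le_abs_self _).trans (B.le_opNorm e)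
    have hnorm : ‖s • n + e‖ ≤ s * N + ‖e‖ := hsN ▸ norm_add_le _ _
    have hnorm' := mul_le_mul_of_nonneg_left hnorm hεpos.le
    rw [hsub, map_add, map_smul, hn, smul_eq_mul] at hmain
    have hneg : b (x + s • n + e) < 0 := by
      have h₁ : ε * (s * N + ‖e‖) = s / 2 + ε * ‖e‖ := by
        rw [mul_add, mul_left_comm, hεN]; ring
      have h₂ : M * ‖e‖ = 2 * (‖B‖ * ‖e‖ + ε * ‖e‖) := by rw [hM]; ring
      linarith
    have : x + s • n + e ∈ {y ∈ U | b y < 0} := ⟨(hball _ hyρ).1, hneg⟩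
    rw [← hΩU] at this
    exact this.1
  refine ⟨r, hrpos, (K * (2 * M * N + 1)).toNNReal, fun v hv =>
    LipschitzOnWith.of_le_add_mul _ fun x hx y hy => ?_⟩
  set δ := ‖x - y‖ with hδ
  have hδr : δ ≤ 2 * r := by
    have h₁ := mem_ball_iff_norm.1 hx.2
    have h₂ := mem_ball_iff_norm.1 hy.2
    calc δ = ‖(x - z) - (y - z)‖ := by rw [hδ]; congr 1; abel
      _ ≤ ‖x - z‖ + ‖y - z‖ := norm_sub_le _ _
      _ ≤ 2 * r := by linarith
  -- Join `y` to `x` inside `Ω` by moving inwards by `t • n`, across by `x - y`, and back: the total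
  -- length is `(2 * M * N + 1) * δ`.
  set t := M * δ with ht
  have ht0 : 0 ≤ t := by positivity
  have htr : t ≤ M * (2 * r) := mul_le_mul_of_nonneg_left hδr hMpos.le
  have hvert : ∀ w ∈ Ω ∩ Metric.ball z r, segment ℝ w (w + t • n) ⊆ Ω := by
    intro w hw
    rw [segment_eq_image']
    rintro _ ⟨θ, hθ, rfl⟩
    have := hstay w hw (θ * t) 0 (mul_nonneg hθ.1 ht0)
      ((mul_le_of_le_one_left ht0 hθ.2).trans htr) (by simp; positivity)
      (by simpa using mul_nonneg hθ.1 ht0)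
    simpa [smul_smul] using this
  have hhor : segment ℝ (y + t • n) (x + t • n) ⊆ Ω := by
    rw [segment_eq_image']
    rintro _ ⟨θ, hθ, rfl⟩
    have hle : ‖θ • (x - y)‖ ≤ δ := by
      rw [norm_smul, Real.norm_of_nonneg hθ.1]
      exact mul_le_of_le_one_left (norm_nonneg _) hθ.2
    have := hstay y hy t (θ • (x - y)) ht0 htr (hle.trans hδr)
      (mul_le_mul_of_nonneg_left hle hMpos.le)
    simpa using this
  have htn : ‖t • n‖ = t * N := by rw [norm_smul, Real.norm_of_nonneg ht0]
  have h₁ := hv _ _ (hvert y hy)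
  have h₂ := hv _ _ hhor
  have h₃ := hv (x + t • n) x (by rw [segment_symm]; exact hvert x hx)
  rw [add_sub_cancel_left, htn] at h₁
  rw [add_sub_add_right_eq_sub, ← hδ] at h₂
  rw [sub_add_cancel_left, norm_neg, htn] at h₃
  have h₄ : K * (2 * M * N + 1) * δ = K * (t * N) + K * δ + K * (t * N) := by rw [ht]; ring
  rw [dist_eq_norm, ← hδ, Real.coe_toNNReal _ (by positivity)]
  linarith

/-- The Lipschitz estimate up to the boundary for continuous functions. -/
theorem HasC2Boundary.exists_lipschitzOnWith_closure (hΩ2 : HasC2Boundary Ω) (hΩ : IsOpen Ω)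
    {K : ℝ} (hK : 0 ≤ K) {z : Eucl d} (hz : z ∈ closure Ω) :
    ∃ r > 0, ∃ C : NNReal, ∀ v : Eucl d → ℝ, ContinuousOn v (closure Ω) →
      (∀ x y, segment ℝ x y ⊆ Ω → v y - v x ≤ K * ‖y - x‖) →
      LipschitzOnWith C v (closure Ω ∩ Metric.ball z r) := by
  obtain ⟨r, hr, C, h⟩ := hΩ2.exists_lipschitzOnWith hΩ hK hz
  refine ⟨r, hr, C, fun v hvc hv => ?_⟩
  have hcl := (lipschitzOnWith_closure_iff
    (hvc.mono (closure_mono inter_subset_left))).2 (h v hv)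
  exact hcl.mono Metric.isOpen_ball.closure_inter

end Boundary

/-! ### Stability and locality of domination -/

section DominationCalculus

variable {d : ℕ} {Ω S : Set (Eucl d)} {L : Eucl d → Eucl d → ℝ} {c : ℝ} {u v : Eucl d → ℝ}

theorem IsDominated.mono (hv : IsDominated Ω L c v) (hS : S ⊆ Ω) : IsDominated S L c v :=
  fun x q h K hh hK => hv x q h K hh fun s hs => ⟨hS (hK s hs).1, (hK s hs).2⟩

theorem IsDominated.congr (hv : IsDominated Ω L c v) (huv : EqOn u v Ω) :
    IsDominated Ω L c u := by
  intro x q h K hh hK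
  have h₀ := (hK 0 (left_mem_Icc.2 hh)).1
  rw [zero_smul, add_zero] at h₀
  rw [huv h₀, huv (hK h (right_mem_Icc.2 hh)).1]
  exact hv x q h K hh hK

theorem IsDominated.max (hu : IsDominated Ω L c u) (hv : IsDominated Ω L c v) :
    IsDominated Ω L c fun x => max (u x) (v x) := by
  intro x q h K hh hK
  have h₁ := hu x q h K hh hK
  have h₂ := hv x q h K hh hK
  have h₃ := le_max_left (u x) (v x)
  have h₄ := le_max_right (u x) (v x)
  simp only [sub_le_iff_le_add]
  exact max_le (by linarith) (by linarith)

/-- Classical subsolutions are dominated. -/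
theorem isDominated_of_inner_gradient_le (hv : Differentiable ℝ v)
    (h : ∀ x ∈ Ω, ∀ q, inner ℝ (gradient v x) q ≤ L x q + c) : IsDominated Ω L c v := by
  intro x q t K ht hK
  have hder := fun s => hasDerivAt_comp_line hv x q s
  have := (convex_Icc (0 : ℝ) t).image_sub_le_mul_sub_of_deriv_le
    (fun s _ => (hder s).continuousAt.continuousWithinAt)
    (fun s _ => (hder s).differentiableAt.differentiableWithinAt) (C := K)
    (fun s hs => by
      have hs' := hK s (interior_subset hs)
      rw [(hder s).deriv]
      exact (h _ hs'.1 q).trans hs'.2)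
    0 (left_mem_Icc.2 ht) t (right_mem_Icc.2 ht) ht
  simpa using this

/-- Domination is a local property of continuous functions. -/
theorem isDominated_of_local (hv : ContinuousOn v Ω)
    (h : ∀ x ∈ Ω, ∃ ρ > 0, IsDominated (Ω ∩ Metric.ball x ρ) L c v) : IsDominated Ω L c v := by
  intro x q t K ht hK
  have hline : Continuous fun s : ℝ => x + s • q := by fun_prop
  have hcont : ContinuousOn (fun s : ℝ => v (x + s • q)) (Icc 0 t) :=
    hv.comp hline.continuousOn fun s hs => (hK s hs).1
  have hB : ∀ s, HasDerivAt (fun s : ℝ => v x + K * s) K s := fun s => by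
    simpa using ((hasDerivAt_id s).const_mul K).const_add (v x)
  -- For a continuous function it suffices to bound right difference quotients, which only involve
  -- short segments.
  have := image_le_of_liminf_slope_right_le_deriv_boundary hcont (B := fun s => v x + K * s)
    (by simp) (fun s _ => (hB s).continuousAt.continuousWithinAt)
    (fun s _ => (hB s).hasDerivWithinAt) (fun s hs r hr => ?_) (right_mem_Icc.2 ht)
  · linarith
  obtain ⟨ρ, hρ, hdom⟩ := h _ (hK s (Ico_subset_Icc_self hs)).1
  obtain ⟨η, hη, hball⟩ := Metric.continuousAt_iff.1 (hline.continuousAt (x := s)) ρ hρ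
  refine Filter.Eventually.frequently ?_
  filter_upwards [Ioo_mem_nhdsGT (lt_min hs.2 (by linarith : s < s + η))] with z hz
  have hzt : z < t := hz.2.trans_le (min_le_left _ _)
  have hzη : z < s + η := hz.2.trans_le (min_le_right _ _)
  have hstep := hdom (x + s • q) q (z - s) K (by linarith [hz.1]) fun τ hτ => by
    rw [add_assoc, ← add_smul]
    have hmem := hK (s + τ) ⟨by linarith [hs.1, hτ.1], by linarith [hτ.2]⟩
    refine ⟨⟨hmem.1, hball ?_⟩, hmem.2⟩
    rw [Real.dist_eq, add_sub_cancel_left, abs_of_nonneg hτ.1]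
    linarith [hτ.2]
  rw [add_assoc, ← add_smul, add_sub_cancel] at hstep
  refine lt_of_le_of_lt ?_ hr
  rw [slope_def_field, div_le_iff₀ (by linarith [hz.1])]
  exact hstep

end DominationCalculus

/-! ### Perron's method -/

section Perron

variable {d : ℕ} {Ω : Set (Eucl d)} {L : Eucl d → Eucl d → ℝ} {c : ℝ} {z : Eucl d}

/-- The functions dominated by `L + c` which are continuous on the closure of `Ω` and vanish
at `z`. -/
def dominatedFamily (Ω : Set (Eucl d)) (L : Eucl d → Eucl d → ℝ) (c : ℝ) (z : Eucl d) :
    Set (Eucl d → ℝ) :=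
  {v | ContinuousOn v (closure Ω) ∧ v z = 0 ∧ IsDominated Ω L c v}

/-- The upper envelope of the dominated functions vanishing at `z`. -/
noncomputable def dominatedEnvelope (Ω : Set (Eucl d)) (L : Eucl d → Eucl d → ℝ) (c : ℝ)
    (z x : Eucl d) : ℝ :=
  ⨆ v : dominatedFamily Ω L c z, (v : Eucl d → ℝ) x

theorem zero_mem_dominatedFamily (h : ∀ x v, 0 ≤ L x v + c) :
    (fun _ => 0) ∈ dominatedFamily Ω L c z := by
  refine ⟨continuousOn_const, rfl, fun x q t K ht hK => ?_⟩
  have := (h _ _).trans (hK 0 (left_mem_Icc.2 ht)).2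
  simpa using mul_nonneg this ht

theorem exists_lipschitzOnWith_dominatedFamily (hL : IsTonelli L) (hΩ : IsOpen Ω)
    (hΩ2 : HasC2Boundary Ω) {y : Eucl d} (hy : y ∈ closure Ω) :
    ∃ r > 0, ∃ C : NNReal, ∀ v ∈ dominatedFamily Ω L c z,
      LipschitzOnWith C v (closure Ω ∩ Metric.ball y r) := by
  obtain ⟨A, hA⟩ := hL.bounded 1
  obtain ⟨r, hr, C, h⟩ := hΩ2.exists_lipschitzOnWith_closure hΩ (abs_nonneg (A + c)) hy
  refine ⟨r, hr, C, fun v hv => h v hv.1 fun x y hxy => hv.2.2.sub_le_of_segment ?_ hxy⟩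
  intro x q hq
  linarith [hA x q hq, le_abs_self (A + c)]

/-- The common local Lipschitz constant propagates boundedness between nearby points, and
connectedness carries it from `z`, where the family vanishes. -/
theorem bddAbove_dominatedFamily (hL : IsTonelli L) (hΩ : IsOpen Ω) (hΩc : IsConnected Ω)
    (hΩ2 : HasC2Boundary Ω) (hz : z ∈ closure Ω) {x : Eucl d} (hx : x ∈ closure Ω) :
    BddAbove (range fun v : dominatedFamily Ω L c z => (v : Eucl d → ℝ) x) := by
  set P : Eucl d → Prop := fun x =>
    BddAbove (range fun v : dominatedFamily Ω L c z => (v : Eucl d → ℝ) x) with hP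
  have hPz : P z := ⟨0, by rintro _ ⟨v, rfl⟩; exact v.2.2.1.le⟩
  refine (hΩc.isPreconnected.closure.induction₂ (fun x y => P x ↔ P y) (fun y hy => ?_)
    (fun _ _ _ _ _ _ h₁ h₂ => h₁.trans h₂) (fun _ _ _ _ h => h.symm) hz hx).1 hPz
  obtain ⟨r, hr, C, h⟩ := exists_lipschitzOnWith_dominatedFamily (c := c) (z := z) hL hΩ hΩ2 hy
  filter_upwards [self_mem_nhdsWithin, mem_nhdsWithin_of_mem_nhds (Metric.ball_mem_nhds y hr)]
    with w hw hwr
  have key : ∀ a ∈ closure Ω ∩ Metric.ball y r, ∀ b ∈ closure Ω ∩ Metric.ball y r,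
      P a → P b := by
    rintro a ha b hb ⟨M, hM⟩
    refine ⟨M + C * dist b a, ?_⟩
    rintro _ ⟨v, rfl⟩
    have h₁ := hM ⟨v, rfl⟩
    have h₂ := (h v v.2).le_add_mul hb ha
    simp only at h₁ ⊢
    linarith
  have hy' : y ∈ closure Ω ∩ Metric.ball y r := ⟨hy, Metric.mem_ball_self hr⟩
  exact ⟨key y hy' w ⟨hw, hwr⟩, key w ⟨hw, hwr⟩ y hy'⟩

theorem le_dominatedEnvelope (hL : IsTonelli L) (hΩ : IsOpen Ω) (hΩc : IsConnected Ω)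
    (hΩ2 : HasC2Boundary Ω) (hz : z ∈ closure Ω) {x : Eucl d} (hx : x ∈ closure Ω)
    {v : Eucl d → ℝ} (hv : v ∈ dominatedFamily Ω L c z) : v x ≤ dominatedEnvelope Ω L c z x :=
  le_ciSup (bddAbove_dominatedFamily hL hΩ hΩc hΩ2 hz hx) ⟨v, hv⟩

/-- The upper envelope of the dominated functions is one of them. -/
theorem dominatedEnvelope_mem (hL : IsTonelli L) (hΩ : IsOpen Ω) (hΩc : IsConnected Ω)
    (hΩ2 : HasC2Boundary Ω) (hz : z ∈ closure Ω) (h0 : ∀ x v, 0 ≤ L x v + c) :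
    dominatedEnvelope Ω L c z ∈ dominatedFamily Ω L c z := by
  have : Nonempty (dominatedFamily Ω L c z) := ⟨⟨_, zero_mem_dominatedFamily h0⟩⟩
  have hle := fun {x : Eucl d} (hx : x ∈ closure Ω) {v : Eucl d → ℝ}
    (hv : v ∈ dominatedFamily Ω L c z) => le_dominatedEnvelope hL hΩ hΩc hΩ2 hz hx hv
  refine ⟨fun y hy => ?_, ?_, fun x q t K ht hK => ?_⟩
  · obtain ⟨r, hr, C, h⟩ := exists_lipschitzOnWith_dominatedFamily (c := c) (z := z) hL hΩ hΩ2 hy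
    have hlip : LipschitzOnWith C (dominatedEnvelope Ω L c z) (closure Ω ∩ Metric.ball y r) := by
      refine LipschitzOnWith.of_le_add_mul _ fun a ha b hb => ciSup_le fun v => ?_
      have h₁ := (h v v.2).le_add_mul ha hb
      have h₂ := hle hb.1 v.2
      linarith
    have hcont := hlip.continuousOn y ⟨hy, Metric.mem_ball_self hr⟩
    rwa [continuousWithinAt_inter (Metric.ball_mem_nhds y hr)] at hcont
  · simp only [dominatedEnvelope]
    exact (iSup_congr fun v => v.2.2.1).trans ciSup_const
  · have hx : x ∈ Ω := by simpa using (hK 0 (left_mem_Icc.2 ht)).1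
    rw [sub_le_iff_le_add]
    refine ciSup_le fun v => ?_
    have h₁ := v.2.2.2 x q t K ht hK
    have h₂ := hle (subset_closure hx) v.2
    linarith

/-- If a smooth function touches `u` from below at `x₀` and is a strict subsolution there, then
`u` is not the largest dominated function. -/
theorem exists_dominated_gt (hL : IsTonelli L) {u φ : Eucl d → ℝ} {x₀ : Eucl d}
    (hu : u ∈ dominatedFamily Ω L c z) (hφ : ContDiff ℝ 1 φ)
    (hne : x₀ ≠ z) (hmin : IsLocalMinOn (fun x => u x - φ x) (closure Ω) x₀)
    (hlt : hamiltonian L x₀ (gradient φ x₀) < c) :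
    ∃ w ∈ dominatedFamily Ω L c z, u x₀ < w x₀ := by
  obtain ⟨huc, huz, hud⟩ := hu
  have hsq : ContDiff ℝ 1 fun x : Eucl d => ‖x - x₀‖ ^ 2 :=
    (contDiff_id.sub contDiff_const).norm_sq ℝ
  -- `ψ a` touches `u - a` strictly from below at `x₀`
  set ψ : ℝ → Eucl d → ℝ := fun a x => φ x - ‖x - x₀‖ ^ 2 + a with hψ
  have hψC : ∀ a, ContDiff ℝ 1 (ψ a) := fun a => (hφ.sub hsq).add contDiff_const
  have hgrad : ∀ a, gradient (ψ a) = gradient (ψ 0) := fun a => by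
    funext x
    simp only [gradient, hψ]
    rw [fderiv_add_const, fderiv_add_const]
  have hgrad₀ : gradient (ψ 0) x₀ = gradient φ x₀ := by
    have h₁ : HasFDerivAt (fun x : Eucl d => ‖x - x₀‖ ^ 2) (0 : Eucl d →L[ℝ] ℝ) x₀ := by
      have := ((hasFDerivAt_id x₀).sub_const x₀).norm_sq
      simpa using this
    have h₂ := ((hφ.differentiable (by norm_num) x₀).hasFDerivAt.sub h₁).add_const 0
    simp only [gradient, hψ]
    congr 1
    simpa using h₂.fderiv
  have hcontg : Continuous (gradient (ψ 0)) :=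
    (InnerProductSpace.toDual ℝ (Eucl d)).symm.continuous.comp
      ((hψC 0).continuous_fderiv (by norm_num))
  have hev₁ := hL.eventually_inner_le hcontg (hgrad₀ ▸ hlt)
  have hev₂ : ∀ᶠ x in 𝓝 x₀, x ∈ closure Ω → u x₀ - φ x₀ ≤ u x - φ x :=
    eventually_nhdsWithin_iff.1 hmin
  have hev₃ : ∀ᶠ x in 𝓝 x₀, x ≠ z := isOpen_ne.mem_nhds hne
  obtain ⟨r, hr, hball⟩ := Metric.eventually_nhds_iff_ball.1 (hev₁.and (hev₂.and hev₃))
  -- The lift `r ^ 2 / 4` puts `ψ a` above `u` at `x₀`, while the quadratic term brings it below `u`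
  -- beyond radius `r / 2`. Gluing is then continuous, and the value at `z` is kept since the ball
  -- avoids `z`.
  set a : ℝ := u x₀ - φ x₀ + r ^ 2 / 4 with ha
  have hψdom : IsDominated (Ω ∩ Metric.ball x₀ r) L c (ψ a) :=
    isDominated_of_inner_gradient_le ((hψC a).differentiable (by norm_num)) fun x hx q => by
      rw [hgrad]
      exact (hball x hx.2).1 q
  classical
  set w : Eucl d → ℝ := fun x => if x ∈ Metric.ball x₀ r then max (u x) (ψ a x) else u x with hw
  have hin : ∀ x ∈ Metric.ball x₀ r, w x = max (u x) (ψ a x) := fun x hx => if_pos hx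
  have hout : ∀ x ∈ closure Ω ∩ (Metric.closedBall x₀ (r / 2))ᶜ, w x = u x := by
    rintro x ⟨hx, hx'⟩
    by_cases hxr : x ∈ Metric.ball x₀ r
    · rw [hin x hxr]
      refine max_eq_left ?_
      have h₁ := (hball x hxr).2.1 hx
      have h₂ : r / 2 < ‖x - x₀‖ := by
        simpa [dist_eq_norm] using hx'
      simp only [hψ, ha]
      nlinarith
    · exact if_neg hxr
  have hcases : ∀ x : Eucl d, x ∈ Metric.ball x₀ r ∨ x ∈ (Metric.closedBall x₀ (r / 2))ᶜ := by
    intro x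
    by_cases hx : x ∈ Metric.ball x₀ r
    · exact Or.inl hx
    · refine Or.inr fun hx' => hx ?_
      exact Metric.closedBall_subset_ball (by linarith) hx'
  have hopen : IsOpen (Metric.closedBall x₀ (r / 2))ᶜ := Metric.isClosed_closedBall.isOpen_compl
  have hwc : ContinuousOn w (closure Ω) := by
    intro x hx
    rcases hcases x with hxr | hxr
    · have hc : ContinuousWithinAt (fun x => max (u x) (ψ a x)) (closure Ω) x :=
        (huc x hx).max (hψC a).continuous.continuousWithinAt
      exact hc.congr_of_eventuallyEq (mem_nhdsWithin_of_mem_nhds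
        (Filter.mem_of_superset (Metric.isOpen_ball.mem_nhds hxr) hin)) (hin x hxr)
    · refine (huc x hx).congr_of_eventuallyEq ?_ (hout x ⟨hx, hxr⟩)
      filter_upwards [self_mem_nhdsWithin, mem_nhdsWithin_of_mem_nhds (hopen.mem_nhds hxr)]
        with y hy hy' using hout y ⟨hy, hy'⟩
  refine ⟨w, ⟨hwc, ?_, isDominated_of_local (hwc.mono subset_closure) fun x hx => ?_⟩, ?_⟩
  · rw [← huz]
    exact if_neg fun h => (hball z h).2.2 rfl
  · rcases hcases x with hxr | hxr
    · obtain ⟨ρ, hρ, hsub⟩ := Metric.isOpen_iff.1 Metric.isOpen_ball x hxr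
      refine ⟨ρ, hρ, IsDominated.congr ?_ fun y hy => hin y (hsub hy.2)⟩
      exact (hud.mono inter_subset_left).max
        (hψdom.mono (inter_subset_inter_right Ω hsub))
    · obtain ⟨ρ, hρ, hsub⟩ := Metric.isOpen_iff.1 hopen x hxr
      exact ⟨ρ, hρ, (hud.mono inter_subset_left).congr fun y hy =>
        hout y ⟨subset_closure hy.1, hsub hy.2⟩⟩
  · rw [hin x₀ (Metric.mem_ball_self hr)]
    refine lt_max_of_lt_right ?_
    simp only [hψ, ha, sub_self, norm_zero]
    nlinarith

/-- The envelope of the dominated functions vanishing at a rest point of the critical level solves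
the state constraint problem. -/
theorem isConstrainedViscositySolution_dominatedEnvelope (hL : IsTonelli L) (hΩ : IsOpen Ω)
    (hΩc : IsConnected Ω) (hΩ2 : HasC2Boundary Ω) (hz : z ∈ closure Ω)
    (hmin : ∀ y v, L z 0 ≤ L y v) :
    IsConstrainedViscositySolution Ω (hamiltonian L) (-L z 0)
      (dominatedEnvelope Ω L (-L z 0) z) := by
  have hmem := dominatedEnvelope_mem hL hΩ hΩc hΩ2 hz (c := -L z 0) fun x v => by
    linarith [hmin x v]
  refine ⟨hmem.1, hmem.2.2.isViscositySubsolutionOn hL hΩ, fun φ hφ x₀ hx₀ hloc => ?_⟩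
  rcases eq_or_ne x₀ z with rfl | hne
  · exact hL.neg_le_hamiltonian _ _
  by_contra! hlt
  obtain ⟨w, hw, hgt⟩ := exists_dominated_gt hL hmem hφ hne hloc hlt
  exact absurd (le_dominatedEnvelope hL hΩ hΩc hΩ2 hz hx₀ hw) (not_le.2 hgt)

end Perron

/-! ### Uniqueness of the constant -/

section Uniqueness

variable {d : ℕ} {Ω : Set (Eucl d)} {L : Eucl d → Eucl d → ℝ} {c : ℝ} {u : Eucl d → ℝ}

/-- A continuous function on an open set is touched from above by paraboloids on a dense set. -/
theorem exists_isLocalMaxOn_sub_norm_sq (hΩ : IsOpen Ω) (hu : ContinuousOn u Ω) {y : Eucl d}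
    (hy : y ∈ Ω) {ε : ℝ} (hε : 0 < ε) :
    ∃ (k : ℝ), ∃ x ∈ Ω, dist x y < ε ∧ IsLocalMaxOn (fun x => u x - k * ‖x - y‖ ^ 2) Ω x := by
  obtain ⟨r, hr, hball⟩ := Metric.isOpen_iff.1 hΩ y hy
  set ρ := min ε r / 2 with hρ
  have hρ0 : 0 < ρ := by positivity
  have hρr : ρ < r := by linarith [min_le_right ε r, lt_min hε hr]
  have hρε : ρ < ε := by linarith [min_le_left ε r, lt_min hε hr]
  have hsub : Metric.closedBall y ρ ⊆ Ω := (Metric.closedBall_subset_ball hρr).trans hball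
  obtain ⟨M, hM⟩ := (isCompact_closedBall y ρ).exists_bound_of_continuousOn (hu.mono hsub)
  have hM0 : 0 ≤ M := (norm_nonneg _).trans (hM y (Metric.mem_closedBall_self hρ0.le))
  -- The penalty on the sphere exceeds the oscillation bound `2 * M`, so the maximum is interior.
  set k : ℝ := (2 * M + 1) / ρ ^ 2 with hk
  have hkρ : k * ρ ^ 2 = 2 * M + 1 := by rw [hk]; field_simp
  have hcont : ContinuousOn (fun x => u x - k * ‖x - y‖ ^ 2) (Metric.closedBall y ρ) :=
    (hu.mono hsub).sub (by fun_prop)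
  obtain ⟨x, hx, hmax⟩ := (isCompact_closedBall y ρ).exists_isMaxOn
    ⟨y, Metric.mem_closedBall_self hρ0.le⟩ hcont
  have hxρ : x ∈ Metric.ball y ρ := by
    by_contra hcon
    have heq : ‖x - y‖ = ρ := by
      rw [← dist_eq_norm]
      exact le_antisymm hx (not_lt.1 hcon)
    have h₁ : u y - k * ‖y - y‖ ^ 2 ≤ u x - k * ‖x - y‖ ^ 2 :=
      hmax (Metric.mem_closedBall_self hρ0.le)
    rw [heq, hkρ, sub_self, norm_zero] at h₁
    have h₂ := (abs_le.1 (hM x hx)).2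
    have h₃ := (abs_le.1 (hM y (Metric.mem_closedBall_self hρ0.le))).1
    linarith
  refine ⟨k, x, hsub hx, lt_trans hxρ hρε, Filter.Eventually.filter_mono nhdsWithin_le_nhds ?_⟩
  filter_upwards [Metric.isOpen_ball.mem_nhds hxρ] with w hw
  exact hmax (Metric.ball_subset_closedBall hw)

/-- Since `H x p ≥ -L x 0` for every `p`, the gradient of the test function is irrelevant; a dense
set of test points and continuity suffice. -/
theorem IsViscositySubsolutionOn.neg_le (hL : IsTonelli L) (hΩ : IsOpen Ω)
    (hu : ContinuousOn u Ω) (h : IsViscositySubsolutionOn Ω (hamiltonian L) c u)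
    {z : Eucl d} (hz : z ∈ closure Ω) : -L z 0 ≤ c := by
  have hcont : Continuous fun x => -L x 0 :=
    (hL.continuous.comp (continuous_id.prodMk continuous_const)).neg
  refine closure_minimal (fun y hy => ?_) (isClosed_le hcont continuous_const) hz
  by_contra hcon
  rw [mem_ofPred_eq, not_le] at hcon
  obtain ⟨ε, hε, hball⟩ := Metric.eventually_nhds_iff.1
    (hcont.continuousAt.eventually (lt_mem_nhds hcon))
  obtain ⟨k, x, hx, hxy, hmax⟩ := exists_isLocalMaxOn_sub_norm_sq hΩ hu hy hε
  have hsmooth : ContDiff ℝ 1 fun x : Eucl d => k * ‖x - y‖ ^ 2 :=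
    contDiff_const.mul ((contDiff_id.sub contDiff_const).norm_sq ℝ)
  have h₁ := h _ hsmooth x hx hmax
  linarith [hball hxy, hL.neg_le_hamiltonian x (gradient (fun x : Eucl d => k * ‖x - y‖ ^ 2) x)]

/-- A constant touches `u` from below at its global minimum, admissible even on the boundary because
minima are taken relative to `S`. -/
theorem IsViscositySupersolutionOn.exists_le {S : Set (Eucl d)} (hS : IsCompact S)
    (hne : S.Nonempty) {H : Eucl d → Eucl d → ℝ} (hu : ContinuousOn u S)
    (h : IsViscositySupersolutionOn S H c u) : ∃ x ∈ S, c ≤ H x 0 := by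
  obtain ⟨x, hx, hmin⟩ := hS.exists_isMinOn hne hu
  refine ⟨x, hx, ?_⟩
  have := h (fun _ => 0) contDiff_const x hx (by simpa using hmin.localize)
  simpa [gradient] using this

theorem IsConstrainedViscositySolution.eq_neg (hL : IsTonelli L)
    (hrev : IsReversible (hamiltonian L)) (hΩ : IsOpen Ω) (hΩb : Bornology.IsBounded Ω)
    (h : IsConstrainedViscositySolution Ω (hamiltonian L) c u) {z : Eucl d}
    (hz : z ∈ closure Ω) (hmin : ∀ y, L z 0 ≤ L y 0) : c = -L z 0 := by
  obtain ⟨hu, hsub, hsup⟩ := h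
  obtain ⟨x, -, hx⟩ := hsup.exists_le hΩb.isCompact_closure ⟨z, hz⟩ hu
  refine le_antisymm ?_ (hsub.neg_le hL hΩ (hu.mono subset_closure) hz)
  linarith [hL.hamiltonian_zero_le hrev x, hmin x]

end Uniqueness

/-- The first conjunct says that `c_H` is well defined, the second that `c_L` is a genuine
supremum, the third that they agree, the fourth that the common value is `-min_x L(x,0)`. -/
theorem proposition3p3 {d : ℕ} (Ω : Set (Eucl d)) (hΩo : IsOpen Ω) (hΩc : IsConnected Ω)
    (hΩb : Bornology.IsBounded Ω) (hΩ2 : HasC2Boundary Ω)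
    (L : Eucl d → Eucl d → ℝ) (hL : IsTonelli L) (hrev : IsReversible (hamiltonian L))
    (hA1 : ({x | ∀ y, L x 0 ≤ L y 0} ∩ closure Ω).Nonempty) :
    (∃! c : ℝ, StateConstraintSolvable Ω (hamiltonian L) c) ∧
    IsLUB (negativeActionLevels L) (maneCriticalValue L) ∧
    constrainedCriticalValue Ω (hamiltonian L) = maneCriticalValue L ∧
    IsLeast (Set.range fun x => L x 0) (-maneCriticalValue L) := by
  obtain ⟨z, hz, hzΩ⟩ := hA1
  have hmin : ∀ y v, L z 0 ≤ L y v := fun y v => (hz y).trans (hL.le_of_reversible hrev y v)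
  have hsol : StateConstraintSolvable Ω (hamiltonian L) (-L z 0) :=
    ⟨_, isConstrainedViscositySolution_dominatedEnvelope hL hΩo hΩc hΩ2 hzΩ hmin⟩
  have huniq : ∀ c, StateConstraintSolvable Ω (hamiltonian L) c → c = -L z 0 :=
    fun c ⟨_, hu⟩ => hu.eq_neg hL hrev hΩo hΩb hzΩ hz
  have hlevels := negativeActionLevels_eq_Iio hmin
  have hmane : maneCriticalValue L = -L z 0 := by
    rw [maneCriticalValue, hlevels, csSup_Iio]
  refine ⟨⟨_, hsol, huniq⟩, ?_, ?_, ?_⟩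
  · rw [hmane, hlevels]
    exact isLUB_Iio
  · rw [hmane]
    exact huniq _ (Classical.epsilon_spec ⟨_, hsol⟩)
  · rw [hmane, neg_neg]
    exact ⟨⟨z, rfl⟩, by rintro _ ⟨y, rfl⟩; exact hz y⟩
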